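/- Let $n\ge 2$ and let $\mathbb{R}^n$ carry the flat metric $g$, with Levi-Civita connection $D$. A \emph{smooth domain} is a nonempty connected open set $\Omega\subset\mathbb{R}^n$ such that every $p\in\Sigma:=\partial\Omega$ has an open neighbourhood $U$ with a function $\rho\in C^\infty(U)$ satisfying $\nabla\rho(p)\neq 0$ and $\Omega\cap U=\{x\in U:\rho(x)<0\}$. Let $\nu$ be the outward unit normal to $\Sigma$, $\hat g$ the metric induced on $\Sigma$, and $h(X,Y)=-\langle \nu, D_XY\rangle$ the second fundamental form, where $X,Y$ are vector fields tangent to $\Sigma$. The domain $\Omega$ is \emph{non-generic} if there is a function $u\in C^\infty(\overline\Omega)$, not identically zero, such that $$-(\Delta u)\,g+\operatorname{Hess}u-u\operatorname{Ric}=0\ \text{ in }\Omega,\qquad u_\nu\,\hat g=u\,h\ \text{ on }\Sigma,$$ (here $\operatorname{Ric}=0$, as $g$ is flat), and it is \emph{simple} non-generic if in addition $\Sigma$ is nonempty and connected, i.e. $\Omega$ has exactly one boundary component. \textbf{Theorem (Classification of simple non-generic domains in $\mathbb{R}^n$).} 1. If $\Omega\subset\mathbb{R}^n$ is a simple non-generic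 domain, then $\partial\Omega$ is either a round sphere $\{x:|x-c|=r\}$ with $c\in\mathbb{R}^n$, $r>0$, or a hyperplane $\{x:\langle a,x\rangle=b\}$ with $a\in\mathbb{R}^n\setminus\{0\}$, $b\in\mathbb{R}$. 2. For all $c\in\mathbb{R}^n$ and $r>0$, both the ball $\{x:|x-c|<r\}$ and the exterior region $\{x:|x-c|>r\}$ are simple non-generic domains with boundary $\{x:|x-c|=r\}$. 3. For all $a\in\mathbb{R}^n\setminus\{0\}$ and $b\in\mathbb{R}$, both half-spaces $\{x:\langle a,x\rangle<b\}$ and $\{x:\langle a,x\rangle>b\}$ are simple non-generic domains with boundary $\{x:\langle a,x\rangle=b\}$. -/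

import Mathlib

open scoped ContDiff RealInnerProductSpace

namespace EuclStatic

/-- The flat space `ℝⁿ`; its Riemannian metric is the inner product on every tangent space. -/
abbrev E (n : ℕ) : Type := EuclideanSpace ℝ (Fin n)

noncomputable section

/-- The Levi-Civita connection `D` of the flat metric: `(D_X Y)(p)` is the derivative of `Y`
at `p` in the direction `X p`. -/
def covDeriv {n : ℕ} (X Y : E n → E n) : E n → E n :=
  fun p => fderiv ℝ Y p (X p)

/-- The curvature `R(X, Y) Z = D_X D_Y Z - D_Y D_X Z - D_[X, Y] Z` of vector fields. -/
def curvature {n : ℕ} (X Y Z : E n → E n) : E n → E n :=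
  fun p => covDeriv X (covDeriv Y Z) p - covDeriv Y (covDeriv X Z) p
    - covDeriv (VectorField.lieBracket ℝ X Y) Z p

/-- The Ricci tensor `Ric(v, w) = tr (z ↦ R(z, v) w)` at `p` (the curvature is tensorial, so
tangent vectors may be extended to constant vector fields). -/
def ricci {n : ℕ} (p v w : E n) : ℝ :=
  ∑ i : Fin n, ⟪EuclideanSpace.basisFun (Fin n) ℝ i,
    curvature (fun _ => EuclideanSpace.basisFun (Fin n) ℝ i) (fun _ => v) (fun _ => w) p⟫

/-- The Hessian of `u` at `p`, as a bilinear form. -/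
def hess {n : ℕ} (u : E n → ℝ) (p v w : E n) : ℝ :=
  iteratedFDeriv ℝ 2 u p ![v, w]

/-- The operator `L* u = -(Δ u) g + Hess u - u Ric`, evaluated at the point `p` on `(v, w)`. -/
def Lstar {n : ℕ} (u : E n → ℝ) (p v w : E n) : ℝ :=
  -(Laplacian.laplacian u p) * ⟪v, w⟫ + hess u p v w - u p * ricci p v w

/-- `ρ`, defined on the open neighbourhood `U` of `p`, is a smooth local defining function
of the open set `Ω` at `p`. -/
structure IsLocalDefining {n : ℕ} (Ω : Set (E n)) (p : E n) (U : Set (E n)) (ρ : E n → ℝ) :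
    Prop where
  isOpen : IsOpen U
  mem : p ∈ U
  contDiffOn : ContDiffOn ℝ ∞ ρ U
  gradient_ne_zero : gradient ρ p ≠ 0
  mem_iff : ∀ x ∈ U, x ∈ Ω ↔ ρ x < 0

/-- A smooth domain of `ℝⁿ`: a nonempty connected open set that near each of its boundary points
lies on one side of a smooth hypersurface, so that `Ω ∪ ∂Ω` is a smooth manifold with boundary
`∂Ω = frontier Ω`. It is complete, being closed in `ℝⁿ`. -/
structure IsSmoothDomain {n : ℕ} (Ω : Set (E n)) : Prop where
  isOpen : IsOpen Ω
  isConnected : IsConnected Ω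
  exists_localDefining : ∀ p ∈ frontier Ω, ∃ U ρ, IsLocalDefining Ω p U ρ

/-- `ν` is the outward unit normal to `∂Ω` at `p ∈ ∂Ω`, that is `∇ρ / |∇ρ|` for a local defining
function `ρ` (any two of them give the same vector). -/
def IsOutwardUnitNormal {n : ℕ} (Ω : Set (E n)) (p ν : E n) : Prop :=
  ∃ U ρ, IsLocalDefining Ω p U ρ ∧ ν = ‖gradient ρ p‖⁻¹ • gradient ρ p

/-- `v` is tangent to `∂Ω` at `q ∈ ∂Ω`: it is orthogonal to the unit normal. -/
def IsTangentAt {n : ℕ} (Ω : Set (E n)) (q v : E n) : Prop :=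
  ∀ ν, IsOutwardUnitNormal Ω q ν → ⟪v, ν⟫ = 0

/-- `Y` is, near `p`, a smooth vector field that is tangent to `∂Ω` along `∂Ω`. -/
def IsTangentFieldNear {n : ℕ} (Ω : Set (E n)) (p : E n) (Y : E n → E n) : Prop :=
  ∃ U : Set (E n), IsOpen U ∧ p ∈ U ∧ ContDiffOn ℝ ∞ Y U ∧
    ∀ q ∈ U ∩ frontier Ω, IsTangentAt Ω q (Y q)

/-- The second fundamental form `h(X, Y) = -⟨ν, D_X Y⟩` at `p`, where `ν` is the unit normal at `p`
and `X`, `Y` are tangent vector fields. -/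
def secondFundamentalForm {n : ℕ} (ν : E n) (X Y : E n → E n) (p : E n) : ℝ :=
  -⟪ν, covDeriv X Y p⟫

/-- `u` is a static potential on `(Ω, ∂Ω)`: a function in `C^∞` of the closure of `Ω` (that is, the
restriction to the closed set `closure Ω` of a smooth function on `ℝⁿ`), not identically zero on
`Ω`, such that `L* u = 0` in `Ω` and `u_ν ĝ = u h` on `∂Ω`. -/
structure IsStaticPotential {n : ℕ} (Ω : Set (E n)) (u : E n → ℝ) : Prop where
  contDiff : ContDiff ℝ ∞ u
  nontrivial : ∃ x ∈ Ω, u x ≠ 0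
  interior_eq : ∀ p ∈ Ω, ∀ v w : E n, Lstar u p v w = 0
  boundary_eq : ∀ p ∈ frontier Ω, ∀ ν, IsOutwardUnitNormal Ω p ν →
    ∀ X Y : E n → E n, IsTangentFieldNear Ω p X → IsTangentFieldNear Ω p Y →
      fderiv ℝ u p ν * ⟪X p, Y p⟫ = u p * secondFundamentalForm ν X Y p

/-- A non-generic domain: a smooth domain that admits a static potential. -/
structure IsNonGeneric {n : ℕ} (Ω : Set (E n)) : Prop extends IsSmoothDomain Ω where
  exists_staticPotential : ∃ u : E n → ℝ, IsStaticPotential Ω u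

/-- A non-generic domain is simple if it has exactly one boundary component. -/
structure IsSimpleNonGeneric {n : ℕ} (Ω : Set (E n)) : Prop extends IsNonGeneric Ω where
  isConnected_frontier : IsConnected (frontier Ω)

end

end EuclStatic

/-! Since Ric vanishes, the interior equation reads Hess u = (Δu) g; its trace and n ≥ 2 give Δu =
0, so Hess u = 0 and u = ⟨a, x⟩ + b on the closure of Ω (`IsStaticPotential.exists_affine`). With a
unit normal field N, the boundary condition becomes u dN(w) = ⟨a, N⟩ w for tangent w
(`IsStaticPotential.smul_fderiv_normal`).

Where u ≠ 0 on the boundary, dN = f · id with f = ⟨a, N⟩/u. Differentiating f u = ⟨a, N⟩ along the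
boundary gives u df + f⟨a, ·⟩ = f⟨a, ·⟩, hence df = 0. This takes the place of the Codazzi equation
and also works for n = 2, where every curve is umbilic. At a boundary zero of u the condition forces
a to be tangent, and a ≠ 0, so u has nonzero tangential derivative there. The zeros are therefore
nowhere dense in the boundary and df = 0 extends across them (`exists_eq_smul_add_of_umbilic`). Thus
locally N = c x + v.

As the boundary is connected, one pair (c, v) serves everywhere. If c ≠ 0, |c x + v| = 1 puts the
boundary on a sphere; if c = 0, ⟨v, x⟩ is constant on it. A separation argument
(`IsSmoothDomain.frontier_eq_of_subset`) shows that the boundary fills the sphere or hyperplane.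

Conversely, if Ω = {ρ < 0} with ∇ρ = l x + g, then h = (l/|∇ρ|) ĝ, so an affine u with ⟨∇u, ∇ρ⟩ = l
u on the boundary is a potential: u = ⟨e, x - c⟩ for spheres, u = 1 for hyperplanes. -/

namespace EuclStatic

/-! ### Regular level sets and their parametrization -/

section Calculus

variable {F : Type*} [NormedAddCommGroup F] [InnerProductSpace ℝ F] [CompleteSpace F]

theorem contDiffOn_gradient {ρ : F → ℝ} {U : Set F} (hU : IsOpen U) (hρ : ContDiffOn ℝ ∞ ρ U) :
    ContDiffOn ℝ ∞ (gradient ρ) U :=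
  (InnerProductSpace.toDual ℝ F).symm.contDiff.comp_contDiffOn
    (hρ.fderiv_of_isOpen hU (m := ∞) (by simp))

open Filter Topology in
/-- A function that vanishes at `p` is negative on a short segment issuing from `p` in a
direction of decrease. -/
theorem eventually_neg_of_inner_gradient_neg {ρ : F → ℝ} {p v : F} (hρ : DifferentiableAt ℝ ρ p)
    (h0 : ρ p = 0) (hv : ⟪gradient ρ p, v⟫ < 0) :
    ∀ᶠ t : ℝ in 𝓝[>] 0, ρ (p + t • v) < 0 := by
  have h1 : HasDerivAt (fun t : ℝ => ρ (p + t • v)) ⟪gradient ρ p, v⟫ 0 := by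
    have h2 : HasDerivAt (fun t : ℝ => p + t • v) v 0 := by
      simpa using ((hasDerivAt_id (0 : ℝ)).smul_const v).const_add p
    have h3 : HasFDerivAt ρ (fderiv ℝ ρ p) (p + (0 : ℝ) • v) := by
      simpa using hρ.hasFDerivAt
    rw [inner_gradient_left]
    exact h3.comp_hasDerivAt (0 : ℝ) h2
  have h4 := (hasDerivAt_iff_tendsto_slope_zero.1 h1).eventually (gt_mem_nhds hv)
  have h5 := h4.filter_mono (nhdsWithin_mono (0 : ℝ) (fun t (ht : 0 < t) => ht.ne'))
  filter_upwards [h5, self_mem_nhdsWithin] with t ht (ht0 : 0 < t)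
  simp only [zero_add, zero_smul, add_zero, h0, sub_zero, smul_eq_mul] at ht
  by_contra! hcon
  exact absurd ht (not_lt.2 (mul_nonneg (inv_pos.2 ht0).le hcon))

omit [CompleteSpace F] in
open Filter Topology in
theorem tendsto_add_smul_nhdsGT_zero (p v : F) :
    Tendsto (fun t : ℝ => p + t • v) (𝓝[>] 0) (𝓝 p) := by
  have h : Continuous (fun t : ℝ => p + t • v) := by fun_prop
  have := (h.tendsto 0).mono_left (nhdsWithin_le_nhds (s := Set.Ioi (0 : ℝ)))
  simpa using this

open Filter Topology in
theorem frequently_neg_of_gradient_ne_zero {ρ : F → ℝ} {p : F} (hg : gradient ρ p ≠ 0)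
    (h0 : ρ p = 0) : ∃ᶠ x in 𝓝 p, ρ x < 0 := by
  have hd : DifferentiableAt ℝ ρ p := by
    by_contra h
    exact hg (gradient_eq_zero_of_not_differentiableAt h)
  have hv : ⟪gradient ρ p, -gradient ρ p⟫ < 0 := by
    rw [inner_neg_right]
    exact neg_neg_of_pos (real_inner_self_pos.2 hg)
  exact (tendsto_add_smul_nhdsGT_zero p _).frequently
    (eventually_neg_of_inner_gradient_neg hd h0 hv).frequently

theorem gradient_neg' (ρ : F → ℝ) (p : F) : gradient (fun x => -ρ x) p = -gradient ρ p := by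
  simp [gradient, fderiv_fun_neg]

open Filter Topology in
theorem frequently_pos_of_gradient_ne_zero {ρ : F → ℝ} {p : F} (hg : gradient ρ p ≠ 0)
    (h0 : ρ p = 0) : ∃ᶠ x in 𝓝 p, 0 < ρ x := by
  have := frequently_neg_of_gradient_ne_zero (ρ := fun x => -ρ x) (p := p)
    (by rw [gradient_neg']; simpa using hg) (by simpa using h0)
  simpa using this

omit [CompleteSpace F] in
/-- Two unit vectors such that the open half-space of one lies in the closed half-space of the
other are equal. -/
theorem unit_eq_of_halfSpace_subset {m n : F} (hm : ‖m‖ = 1) (hn : ‖n‖ = 1)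
    (h : ∀ v, ⟪m, v⟫ < 0 → ⟪n, v⟫ ≤ 0) : m = n := by
  by_contra hne
  have h1 : ⟪m, n⟫ < 1 := (inner_lt_one_iff_real_of_norm_eq_one hm hn).2 hne
  have h2 := h (n - m) (by rw [inner_sub_right, real_inner_self_eq_norm_sq, hm]; linarith)
  rw [inner_sub_right, real_inner_self_eq_norm_sq, hn, real_inner_comm] at h2
  linarith

open Filter Topology Metric in
/-- Local parametrization of a smooth hypersurface `ρ = 0` near a regular point. The parameter
domain is a ball of the ambient space, the direction of the gradient being collapsed. -/
theorem exists_hypersurface_param {U : Set F} {ρ : F → ℝ} {p : F} (hU : IsOpen U) (hp : p ∈ U)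
    (hρ : ContDiffOn ℝ ∞ ρ U) (h0 : ρ p = 0) (hg : gradient ρ p ≠ 0) :
    ∃ G : F → F, ∃ r > 0, ContDiffOn ℝ 2 G (ball p r) ∧ G p = p ∧
      (∀ y ∈ ball p r, G y ∈ U ∧ ρ (G y) = 0 ∧
        ∀ a, ⟪gradient ρ (G y), a⟫ = 0 → fderiv ℝ G y a = a) ∧
      ∀ V ∈ 𝓝 p, ∀ᶠ x in 𝓝 p, ρ x = 0 → x ∈ G '' V := by
  set g := gradient ρ p with hgdef
  -- Normalized so that `⟪g, e⟫ = 1`.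
  set e : F := (‖g‖ ^ 2)⁻¹ • g with he
  have hge : ⟪g, e⟫ = 1 := by
    rw [he, inner_smul_right, real_inner_self_eq_norm_sq]
    exact inv_mul_cancel₀ (by positivity)
  -- Replaces the coordinate `⟪g, x - p⟫` by `ρ x`: this straightens the hypersurface to a
  -- hyperplane and has derivative the identity at `p`.
  set Φ : F → F := fun x => x + (ρ x - ⟪g, x - p⟫) • e with hΦdef
  have hUn : U ∈ 𝓝 p := hU.mem_nhds hp
  have hρd : ∀ x ∈ U, HasFDerivAt ρ (fderiv ℝ ρ x) x := fun x hx =>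
    ((hρ.contDiffAt (hU.mem_nhds hx)).differentiableAt (by simp)).hasFDerivAt
  have hΦd : ∀ x ∈ U, HasFDerivAt Φ (ContinuousLinearMap.id ℝ F +
      (fderiv ℝ ρ x - innerSL ℝ g).smulRight e) x := by
    intro x hx
    have h1 : HasFDerivAt (fun x : F => ⟪g, x - p⟫) (innerSL ℝ g) x := by
      have := (innerSL ℝ g).hasFDerivAt.comp x ((hasFDerivAt_id x).sub_const p)
      simpa using! this
    exact (hasFDerivAt_id x).add (((hρd x hx).sub h1).smul_const e)
  have hΦp' : HasFDerivAt Φ ((ContinuousLinearEquiv.refl ℝ F : F ≃L[ℝ] F) : F →L[ℝ] F) p := by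
    have h1 : fderiv ℝ ρ p = innerSL ℝ g := by
      ext v
      rw [innerSL_apply_apply, hgdef, inner_gradient_left]
    have h2 := hΦd p hp
    rw [h1, sub_self] at h2
    convert! h2
    ext v; simp
  have hΦp : Φ p = p := by simp [hΦdef, h0]
  have hΦc : ContDiffAt ℝ ∞ Φ p := by
    have h1 : ContDiffAt ℝ ∞ ρ p := hρ.contDiffAt hUn
    have h2 : ContDiffAt ℝ ∞ (fun x : F => ⟪g, x - p⟫) p :=
      contDiffAt_const.inner ℝ (contDiffAt_id.sub contDiffAt_const)
    exact contDiffAt_id.add ((h1.sub h2).smul contDiffAt_const)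
  have h2inf : (2 : WithTop ℕ∞) ≤ ∞ :=
    WithTop.coe_le_coe.2 (le_top : (2 : ℕ∞) ≤ ⊤)
  have hn : (∞ : WithTop ℕ∞) ≠ 0 := by simp
  set Ψ : F → F := hΦc.localInverse hΦp' hn with hΨdef
  have hΨp : Ψ p = p := by
    have := hΦc.localInverse_apply_image hΦp' hn
    rwa [hΦp] at this
  have hΨc : ContDiffAt ℝ ∞ Ψ p := by
    have := hΦc.to_localInverse hΦp' hn
    rwa [hΦp] at this
  have hstr := hΦc.hasStrictFDerivAt' hΦp' hn
  have hleft : ∀ᶠ x in 𝓝 p, Ψ (Φ x) = x := hstr.eventually_left_inverse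
  have hright : ∀ᶠ y in 𝓝 p, Φ (Ψ y) = y := by
    have := hstr.eventually_right_inverse
    rwa [hΦp] at this
  -- Projection along `e` onto the hyperplane; the parametrization is `Ψ ∘ Q`.
  set Q : F → F := fun y => y - ⟪g, y - p⟫ • e with hQdef
  have hQp : Q p = p := by simp [hQdef]
  have hQc : ContDiff ℝ ∞ Q :=
    contDiff_id.sub ((contDiff_const.inner ℝ (contDiff_id.sub contDiff_const)).smul contDiff_const)
  have hQd : ∀ y, HasFDerivAt Q (ContinuousLinearMap.id ℝ F - (innerSL ℝ g).smulRight e) y := by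
    intro y
    have h1 : HasFDerivAt (fun x : F => ⟪g, x - p⟫) (innerSL ℝ g) y := by
      have := (innerSL ℝ g).hasFDerivAt.comp y ((hasFDerivAt_id y).sub_const p)
      simpa using! this
    exact (hasFDerivAt_id y).sub (h1.smul_const e)
  have hgQ : ∀ y, ⟪g, Q y - p⟫ = 0 := by
    intro y
    have : Q y - p = (y - p) - ⟪g, y - p⟫ • e := by simp only [hQdef]; abel
    rw [this, inner_sub_right, inner_smul_right, hge]; ring
  have hQt : Tendsto Q (𝓝 p) (𝓝 p) := by
    simpa [hQp] using hQc.continuous.tendsto p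
  have hΨt : Tendsto Ψ (𝓝 p) (𝓝 p) := by
    simpa [ContinuousAt, hΨp] using hΨc.continuousAt
  have hgΦ : ∀ x, ⟪g, Φ x - p⟫ = ρ x := by
    intro x
    have : Φ x - p = (x - p) + (ρ x - ⟪g, x - p⟫) • e := by simp only [hΦdef]; abel
    rw [this, inner_add_right, inner_smul_right, hge]; ring
  have hΨev : ∀ᶠ z in 𝓝 p, ContDiffAt ℝ 2 Ψ z :=
    (hΨc.of_le h2inf).eventually (by simp)
  have hall := (hQt.eventually hΨev).and ((hQt.eventually hright).and
    (((hΨt.comp hQt).eventually hleft.eventually_nhds).and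
      ((hΨt.comp hQt).eventually hUn)))
  obtain ⟨r, hr, hball⟩ := Metric.eventually_nhds_iff_ball.1 hall
  refine ⟨Ψ ∘ Q, r, hr, ?_, by simp [hQp, hΨp], ?_, ?_⟩
  · intro y hy
    exact ((hball y hy).1.comp y (hQc.of_le h2inf).contDiffAt).contDiffWithinAt
  · intro y hy
    obtain ⟨h1, h2, h3, h4⟩ := hball y hy
    refine ⟨h4, ?_, ?_⟩
    · rw [← hgΦ]
      simp only [Function.comp]
      rw [h2, hgQ]
    -- If `dρ a = 0`, then `dΦ a = a - ⟪g, a⟫ • e = dQ a`, so `dΨ (dQ a) = dΨ (dΦ a) = a`.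
    · intro a ha
      have hd1 : HasFDerivAt Ψ (fderiv ℝ Ψ (Q y)) (Q y) :=
        (h1.differentiableAt (by simp)).hasFDerivAt
      have hd2 := hd1.comp y (hQd y)
      rw [hd2.fderiv]
      have hd3 := hΦd (Ψ (Q y)) h4
      have hd1' : HasFDerivAt Ψ (fderiv ℝ Ψ (Q y)) (Φ (Ψ (Q y))) := by rwa [h2]
      have hd4 := (hd1'.comp _ hd3).unique
        ((hasFDerivAt_id (Ψ (Q y))).congr_of_eventuallyEq h3)
      have hd5 := congrArg (fun T : F →L[ℝ] F => T a) hd4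
      have h6 : fderiv ℝ ρ (Ψ (Q y)) a = 0 := by rw [← inner_gradient_left]; exact ha
      simpa [h6, sub_eq_add_neg] using hd5
  · intro V hV
    have hΦt : Tendsto Φ (𝓝 p) (𝓝 p) := by
      simpa [ContinuousAt, hΦp] using hΦc.continuousAt
    filter_upwards [hleft, hΦt.eventually hV] with x hx hx' hx0
    refine ⟨Φ x, hx', ?_⟩
    have : Q (Φ x) = Φ x := by simp [hQdef, hgΦ, hx0]
    simp [this, hx]

end Calculus

end EuclStatic

namespace EuclStatic

/-! ### Umbilicity with a constant factor -/

section Calculus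

open Filter Topology in
/-- A function continuous on an open set that vanishes on a dense subset vanishes. -/
theorem eq_zero_of_frequently {X H : Type*} [TopologicalSpace X] [TopologicalSpace H] [T1Space H] [Zero H]
    {V : Set X} (hV : IsOpen V) {f : X → H} (hf : ContinuousOn f V) {y : X} (hy : y ∈ V)
    (h : ∃ᶠ z in 𝓝 y, z ∈ V → f z = 0) : f y = 0 := by
  by_contra hne
  have h1 := (hf.continuousAt (hV.mem_nhds hy)).eventually (isOpen_compl_singleton.mem_nhds hne)
  obtain ⟨z, hz1, hz2, hz3⟩ := (h.and_eventually (h1.and (hV.mem_nhds hy))).exists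
  exact hz2 (hz1 hz3)

variable {F : Type*} [NormedAddCommGroup F] [InnerProductSpace ℝ F]

open Filter Topology Metric in
/-- A regular zero of a function is a limit of points where the function does not vanish. -/
theorem frequently_ne_zero_of_fderiv_ne_zero {w : F → ℝ} {y : F} (h : fderiv ℝ w y ≠ 0) :
    ∃ᶠ z in 𝓝 y, w z ≠ 0 := by
  intro hcon
  have h1 : w =ᶠ[𝓝 y] fun _ => (0 : ℝ) := by
    filter_upwards [hcon] with z hz
    simpa using hz
  exact h (by rw [h1.fderiv_eq]; simp)

open Filter Topology Metric in
/-- If the differentials of `N` and `G` are related by `w dN = ⟪a, N⟫ dG`, where `w = ⟪a, G⟫ + b`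
has only regular zeros, then `N` is an affine function of `G`. -/
theorem exists_eq_smul_add_of_umbilic {G N : F → F} {p : F} {r : ℝ}
    (hG : ContDiffOn ℝ 2 G (ball p r)) (hN : ContDiffOn ℝ 2 N (ball p r)) (a : F) (b : ℝ)
    (h : ∀ y ∈ ball p r, ∀ η,
      (⟪a, G y⟫ + b) • fderiv ℝ N y η = ⟪a, N y⟫ • fderiv ℝ G y η)
    (hz : ∀ y ∈ ball p r, ⟪a, G y⟫ + b = 0 → ∃ η, ⟪a, fderiv ℝ G y η⟫ ≠ 0)
    (ξ : F) (hξ : ∀ y ∈ ball p r, fderiv ℝ G y ξ ≠ 0) :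
    ∃ (c : ℝ) (v : F), ∀ y ∈ ball p r, N y = c • G y + v := by
  rcases le_or_gt r 0 with hr | hr
  · exact ⟨0, 0, fun y hy => by simp [ball_eq_empty.2 hr] at hy⟩
  have hVo : IsOpen (ball p r) := isOpen_ball
  have hVc : IsPreconnected (ball p r) := (convex_ball p r).isPreconnected
  set w : F → ℝ := fun y => ⟪a, G y⟫ + b with hw
  have hGd : ∀ y ∈ ball p r, HasFDerivAt G (fderiv ℝ G y) y := fun y hy =>
    ((hG.contDiffAt (hVo.mem_nhds hy)).differentiableAt (by simp)).hasFDerivAt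
  have hNd : ∀ y ∈ ball p r, HasFDerivAt N (fderiv ℝ N y) y := fun y hy =>
    ((hN.contDiffAt (hVo.mem_nhds hy)).differentiableAt (by simp)).hasFDerivAt
  have hwd : ∀ y ∈ ball p r, HasFDerivAt w ((innerSL ℝ a).comp (fderiv ℝ G y)) y := fun y hy =>
    ((innerSL ℝ a).hasFDerivAt.comp y (hGd y hy)).add_const b
  have hφd : ∀ y ∈ ball p r,
      HasFDerivAt (fun y => ⟪a, N y⟫) ((innerSL ℝ a).comp (fderiv ℝ N y)) y := fun y hy =>
    (innerSL ℝ a).hasFDerivAt.comp y (hNd y hy)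
  have hdense : ∀ y ∈ ball p r, ∃ᶠ z in 𝓝 y, w z ≠ 0 := by
    intro y hy
    by_cases hy0 : w y = 0
    · obtain ⟨η, hη⟩ := hz y hy hy0
      refine frequently_ne_zero_of_fderiv_ne_zero fun hcon => hη ?_
      rw [(hwd y hy).fderiv] at hcon
      simpa using congrArg (fun T : F →L[ℝ] ℝ => T η) hcon
    · exact ((hwd y hy).continuousAt.eventually_ne hy0).frequently
  have hdG : ContDiffOn ℝ 1 (fderiv ℝ G) (ball p r) :=
    hG.fderiv_of_isOpen hVo (by norm_num)
  have hdN : ContDiffOn ℝ 1 (fderiv ℝ N) (ball p r) :=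
    hN.fderiv_of_isOpen hVo (by norm_num)
  -- A formula for the factor `⟪a, N⟫ / w` that remains `C^1` across the zeros of `w`.
  set f : F → ℝ := fun y => ⟪fderiv ℝ N y ξ, fderiv ℝ G y ξ⟫ / ‖fderiv ℝ G y ξ‖ ^ 2 with hf
  have hfc : ContDiffOn ℝ 1 f (ball p r) := by
    have h1 : ContDiffOn ℝ 1 (fun y => fderiv ℝ G y ξ) (ball p r) := hdG.clm_apply contDiffOn_const
    have h2 : ContDiffOn ℝ 1 (fun y => fderiv ℝ N y ξ) (ball p r) := hdN.clm_apply contDiffOn_const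
    exact (h2.inner ℝ h1).div (h1.norm_sq ℝ) fun y hy => by
      have := hξ y hy
      positivity
  have hdNf : ∀ y ∈ ball p r, w y ≠ 0 →
      fderiv ℝ N y = (⟪a, N y⟫ / w y) • fderiv ℝ G y := by
    intro y hy hwy
    ext1 η
    have := h y hy η
    rw [smul_apply, div_eq_inv_mul, mul_smul, ← this, smul_smul,
      inv_mul_cancel₀ hwy, one_smul]
  have hfw : ∀ y ∈ ball p r, w y ≠ 0 → f y = ⟪a, N y⟫ / w y := by
    intro y hy hwy
    have h1 := hξ y hy
    simp only [hf]
    rw [hdNf y hy hwy, smul_apply, real_inner_smul_left,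
      real_inner_self_eq_norm_sq]
    field_simp
  have hfd0 : ∀ y ∈ ball p r, w y ≠ 0 → fderiv ℝ f y = 0 := by
    intro y hy hwy
    -- In the derivative of this identity `⟪a, dN⟫ = f dw` cancels, leaving `w df = 0`.
    have h1 : (fun z => f z * w z) =ᶠ[𝓝 y] fun z => ⟪a, N z⟫ := by
      filter_upwards [hVo.mem_nhds hy, (hwd y hy).continuousAt.eventually_ne hwy] with z hz1 hz2
      rw [hfw z hz1 hz2, div_mul_cancel₀ _ hz2]
    have h2 : HasFDerivAt f (fderiv ℝ f y) y :=
      ((hfc.contDiffAt (hVo.mem_nhds hy)).differentiableAt (by simp)).hasFDerivAt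
    have h3 := ((h2.mul (hwd y hy)).congr_of_eventuallyEq h1.symm).unique (hφd y hy)
    rw [hdNf y hy hwy, ← hfw y hy hwy] at h3
    ext η
    have h4 := congrArg (fun T : F →L[ℝ] ℝ => T η) h3
    simpa [real_inner_smul_right, hwy] using h4
  have hfd : ∀ y ∈ ball p r, fderiv ℝ f y = 0 := by
    intro y hy
    refine eq_zero_of_frequently hVo
      (hfc.continuousOn_fderiv_of_isOpen hVo le_rfl) hy ((hdense y hy).mono fun z hz1 hz2 => ?_)
    exact hfd0 z hz2 hz1
  obtain ⟨c, hc⟩ := hVo.exists_is_const_of_fderiv_eq_zero hVc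
    (hfc.differentiableOn (by simp)) (fun y hy => hfd y hy)
  have hNG : ∀ y ∈ ball p r, fderiv ℝ N y - c • fderiv ℝ G y = 0 := by
    intro y hy
    refine eq_zero_of_frequently (f := fun y => fderiv ℝ N y - c • fderiv ℝ G y) hVo
      (hdN.continuousOn.sub (hdG.continuousOn.const_smul c)) hy
      ((hdense y hy).mono fun z hz1 hz2 => ?_)
    rw [hdNf z hz2 hz1, ← hfw z hz2 hz1, hc z hz2, sub_self]
  obtain ⟨v, hv⟩ := hVo.exists_is_const_of_fderiv_eq_zero (f := fun y => N y - c • G y) hVc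
    (fun y hy => ((hNd y hy).sub ((hGd y hy).const_smul c)).differentiableAt.differentiableWithinAt)
    (fun y hy => by
      have := ((hNd y hy).sub ((hGd y hy).const_smul c)).fderiv
      exact this.trans (hNG y hy))
  exact ⟨c, v, fun y hy => by rw [← hv y hy]; abel⟩

end Calculus

/-! ### Local defining functions, normals and tangent vectors -/

section Domain

variable {n : ℕ} {Ω U : Set (E n)} {ρ : E n → ℝ} {p : E n}

open Filter Topology

theorem IsLocalDefining.of_regular {q : E n} (h : IsLocalDefining Ω p U ρ) (hq : q ∈ U)
    (hg : gradient ρ q ≠ 0) : IsLocalDefining Ω q U ρ :=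
  ⟨h.isOpen, hq, h.contDiffOn, hg, h.mem_iff⟩

/-- A local defining function has no critical points near the point where it is centred. -/
theorem IsLocalDefining.exists_regular (h : IsLocalDefining Ω p U ρ) :
    ∃ V ⊆ U, IsLocalDefining Ω p V ρ ∧ ∀ x ∈ V, gradient ρ x ≠ 0 := by
  have h1 : IsOpen (U ∩ gradient ρ ⁻¹' {0}ᶜ) :=
    (contDiffOn_gradient h.isOpen h.contDiffOn).continuousOn.isOpen_inter_preimage h.isOpen
      isOpen_compl_singleton
  exact ⟨_, Set.inter_subset_left, ⟨h1, ⟨h.mem, h.gradient_ne_zero⟩,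
    h.contDiffOn.mono Set.inter_subset_left, h.gradient_ne_zero,
    fun x hx => h.mem_iff x hx.1⟩, fun x hx => hx.2⟩

theorem IsLocalDefining.eq_zero (h : IsLocalDefining Ω p U ρ) (hΩ : IsOpen Ω) {q : E n}
    (hq : q ∈ U) (hqf : q ∈ frontier Ω) : ρ q = 0 := by
  rw [hΩ.frontier_eq] at hqf
  have h1 : ¬ ρ q < 0 := fun hlt => hqf.2 ((h.mem_iff q hq).2 hlt)
  refine le_antisymm ?_ (not_lt.1 h1)
  by_contra! h2
  have h3 := (h.contDiffOn.continuousOn.continuousAt (h.isOpen.mem_nhds hq)).eventually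
    (lt_mem_nhds h2)
  obtain ⟨z, hz1, hz2, hz3⟩ :=
    ((mem_closure_iff_frequently.1 hqf.1).and_eventually (h3.and (h.isOpen.mem_nhds hq))).exists
  exact absurd ((h.mem_iff z hz3).1 hz1) (not_lt.2 hz2.le)

theorem IsLocalDefining.mem_frontier (h : IsLocalDefining Ω p U ρ) (hΩ : IsOpen Ω)
    (h0 : ρ p = 0) : p ∈ frontier Ω := by
  rw [hΩ.frontier_eq]
  refine ⟨mem_closure_iff_frequently.2 ?_, fun hp => ?_⟩
  · exact ((frequently_neg_of_gradient_ne_zero h.gradient_ne_zero h0).and_eventually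
      (h.isOpen.mem_nhds h.mem)).mono fun x hx => (h.mem_iff x hx.2).2 hx.1
  · exact absurd ((h.mem_iff p h.mem).1 hp) (by simp [h0])

theorem IsLocalDefining.differentiableAt (h : IsLocalDefining Ω p U ρ) :
    DifferentiableAt ℝ ρ p :=
  (h.contDiffOn.contDiffAt (h.isOpen.mem_nhds h.mem)).differentiableAt (by simp)

theorem norm_unit {g : E n} (hg : g ≠ 0) : ‖‖g‖⁻¹ • g‖ = 1 := by
  rw [norm_smul, norm_inv, norm_norm, inv_mul_cancel₀ (norm_ne_zero_iff.2 hg)]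

/-- A direction in which `ρ` decreases points into `Ω`, so `ρ'` cannot increase along it; comparing
half-spaces identifies the unit gradients. Hence the outward normal is well defined. -/
theorem IsLocalDefining.unit_gradient_eq {U' : Set (E n)} {ρ' : E n → ℝ}
    (h : IsLocalDefining Ω p U ρ) (h' : IsLocalDefining Ω p U' ρ') (hΩ : IsOpen Ω)
    (hp : p ∈ frontier Ω) :
    ‖gradient ρ p‖⁻¹ • gradient ρ p = ‖gradient ρ' p‖⁻¹ • gradient ρ' p := by
  refine unit_eq_of_halfSpace_subset (norm_unit h.gradient_ne_zero)
    (norm_unit h'.gradient_ne_zero) fun v hv => ?_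
  rw [real_inner_smul_left] at hv ⊢
  have hv1 : ⟪gradient ρ p, v⟫ < 0 := by
    by_contra! hcon
    exact absurd hv (not_lt.2 (mul_nonneg (by positivity) hcon))
  refine mul_nonpos_of_nonneg_of_nonpos (by positivity) ?_
  by_contra! hcon
  have h1 := eventually_neg_of_inner_gradient_neg h.differentiableAt (h.eq_zero hΩ h.mem hp) hv1
  have h0' := h'.eq_zero hΩ h'.mem hp
  have h2 := eventually_neg_of_inner_gradient_neg (ρ := fun x => -ρ' x) (v := v)
    h'.differentiableAt.neg (by simpa using h0') (by rw [gradient_neg', inner_neg_left]; linarith)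
  have ht := tendsto_add_smul_nhdsGT_zero p v
  obtain ⟨t, ht1, ht2, ht3, ht4⟩ := (h1.and (h2.and ((ht.eventually (h.isOpen.mem_nhds h.mem)).and
    (ht.eventually (h'.isOpen.mem_nhds h'.mem))))).exists
  have := (h'.mem_iff _ ht4).1 ((h.mem_iff _ ht3).2 ht1)
  linarith

theorem IsLocalDefining.isOutwardUnitNormal_iff (h : IsLocalDefining Ω p U ρ) (hΩ : IsOpen Ω)
    (hp : p ∈ frontier Ω) {ν : E n} :
    IsOutwardUnitNormal Ω p ν ↔ ν = ‖gradient ρ p‖⁻¹ • gradient ρ p := by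
  constructor
  · rintro ⟨U', ρ', h', rfl⟩
    exact h'.unit_gradient_eq h hΩ hp
  · rintro rfl
    exact ⟨U, ρ, h, rfl⟩

theorem IsLocalDefining.isTangentAt_iff (h : IsLocalDefining Ω p U ρ) (hΩ : IsOpen Ω)
    (hp : p ∈ frontier Ω) {v : E n} : IsTangentAt Ω p v ↔ ⟪gradient ρ p, v⟫ = 0 := by
  have hne : ‖gradient ρ p‖⁻¹ ≠ 0 := inv_ne_zero (norm_ne_zero_iff.2 h.gradient_ne_zero)
  constructor
  · intro hv
    have := hv _ ((h.isOutwardUnitNormal_iff hΩ hp).2 rfl)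
    rw [real_inner_smul_right, real_inner_comm] at this
    exact (mul_eq_zero.1 this).resolve_left hne
  · intro hv ν hν
    rw [(h.isOutwardUnitNormal_iff hΩ hp).1 hν, real_inner_smul_right, real_inner_comm, hv,
      mul_zero]

/-- The derivative of a function vanishing on the boundary is zero in tangential directions. -/
theorem IsLocalDefining.fderiv_eq_zero_of_tangent (h : IsLocalDefining Ω p U ρ) (hΩ : IsOpen Ω)
    (hp : p ∈ frontier Ω) {ψ : E n → ℝ} (hψ : DifferentiableAt ℝ ψ p)
    (h0 : ∀ᶠ x in 𝓝 p, x ∈ frontier Ω → ψ x = 0) {v : E n} (hv : ⟪gradient ρ p, v⟫ = 0) :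
    fderiv ℝ ψ p v = 0 := by
  obtain ⟨V, -, hV, hreg⟩ := h.exists_regular
  obtain ⟨G, r, hr, hG, hGp, hGV, -⟩ := exists_hypersurface_param hV.isOpen hV.mem hV.contDiffOn
    (hV.eq_zero hΩ hV.mem hp) hV.gradient_ne_zero
  have hpr := Metric.mem_ball_self (x := p) hr
  have hGc := hG.contDiffAt (Metric.isOpen_ball.mem_nhds hpr)
  have hGd : HasFDerivAt G (fderiv ℝ G p) p := (hGc.differentiableAt (by simp)).hasFDerivAt
  have hGv : fderiv ℝ G p v = v := (hGV p hpr).2.2 v (by rwa [hGp])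
  have ht : Tendsto G (𝓝 p) (𝓝 p) := by simpa [ContinuousAt, hGp] using hGc.continuousAt
  have h1 : (ψ ∘ G) =ᶠ[𝓝 p] fun _ => (0 : ℝ) := by
    filter_upwards [ht.eventually h0, Metric.isOpen_ball.mem_nhds hpr] with y hy hyr
    obtain ⟨hy1, hy2, -⟩ := hGV y hyr
    exact hy ((hV.of_regular hy1 (hreg _ hy1)).mem_frontier hΩ hy2)
  have h2 : HasFDerivAt ψ (fderiv ℝ ψ p) (G p) := by rw [hGp]; exact hψ.hasFDerivAt
  have h3 := (h2.comp p hGd).unique ((hasFDerivAt_const (0 : ℝ) p).congr_of_eventuallyEq h1)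
  simpa [hGv] using congrArg (fun T : E n →L[ℝ] ℝ => T v) h3

end Domain

end EuclStatic

namespace EuclStatic

open Filter Topology

/-! ### The static equations in flat space -/

section StaticEquation

variable {n : ℕ} {Ω U : Set (E n)} {ρ u : E n → ℝ} {p : E n}

theorem covDeriv_const (X : E n → E n) (w : E n) : covDeriv X (fun _ => w) = 0 := by
  funext q
  simp [covDeriv]

theorem ricci_eq_zero (p v w : E n) : ricci p v w = 0 := by
  simp [ricci, curvature, covDeriv_const, covDeriv]

theorem laplacian_eq_sum_hess (u : E n → ℝ) (p : E n) :
    Laplacian.laplacian u p = ∑ i, hess u p (EuclideanSpace.basisFun (Fin n) ℝ i)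
      (EuclideanSpace.basisFun (Fin n) ℝ i) := by
  rw [InnerProductSpace.laplacian_eq_iteratedFDeriv_orthonormalBasis u
    (EuclideanSpace.basisFun (Fin n) ℝ)]
  rfl

/-- In dimension at least two the operator `L*` has the same kernel as the Hessian. -/
theorem lstar_eq_zero_iff (hn : 2 ≤ n) :
    (∀ v w, Lstar u p v w = 0) ↔ ∀ v w, hess u p v w = 0 := by
  constructor
  · intro h
    have h1 : ∀ v w, hess u p v w = Laplacian.laplacian u p * ⟪v, w⟫ := by
      intro v w
      have := h v w
      rw [Lstar, ricci_eq_zero] at this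
      linarith
    -- Trace of the previous identity.
    have h2 : Laplacian.laplacian u p = n * Laplacian.laplacian u p := by
      conv_lhs => rw [laplacian_eq_sum_hess]
      simp [h1]
    have h3 : (2 : ℝ) ≤ n := by exact_mod_cast hn
    have h4 : Laplacian.laplacian u p = 0 := by
      have : ((n : ℝ) - 1) * Laplacian.laplacian u p = 0 := by linarith
      exact (mul_eq_zero.1 this).resolve_left (by linarith)
    intro v w
    rw [h1, h4, zero_mul]
  · intro h v w
    simp [Lstar, ricci_eq_zero, laplacian_eq_sum_hess, h]

/-- A static potential is an affine function. -/
theorem IsStaticPotential.exists_affine (hn : 2 ≤ n) (hΩ : IsSmoothDomain Ω)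
    (hu : IsStaticPotential Ω u) :
    ∃ (a : E n) (b : ℝ), ∀ x ∈ closure Ω, u x = ⟪a, x⟫ + b ∧ fderiv ℝ u x = innerSL ℝ a := by
  have hd : Differentiable ℝ u := hu.contDiff.differentiable (by simp)
  have hd2 : ContDiff ℝ ∞ (fderiv ℝ u) := hu.contDiff.fderiv_right (by simp)
  have hpre := hΩ.isConnected.isPreconnected
  obtain ⟨T, hT⟩ := hΩ.isOpen.exists_is_const_of_fderiv_eq_zero hpre
    (hd2.differentiable (by simp)).differentiableOn (fun x hx => by
      ext v w
      have := (lstar_eq_zero_iff hn).1 (hu.interior_eq x hx) v w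
      simpa [hess, iteratedFDeriv_two_apply] using this)
  set a : E n := (InnerProductSpace.toDual ℝ (E n)).symm T with ha
  have haT : innerSL ℝ a = T := by
    ext v
    simp [ha]
  obtain ⟨b, hb⟩ := hΩ.isOpen.exists_is_const_of_fderiv_eq_zero hpre
    (f := fun x => u x - innerSL ℝ a x)
    (hd.sub (innerSL ℝ a).differentiable).differentiableOn (fun x hx => by
      have := ((hd x).hasFDerivAt.sub (innerSL ℝ a).hasFDerivAt).fderiv
      rw [hT x hx, haT, sub_self] at this
      rw [haT]
      exact this)
  refine ⟨a, b, fun x hx => ⟨?_, ?_⟩⟩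
  · have h1 : Set.EqOn u (fun x => ⟪a, x⟫ + b) Ω := fun x hx => by
      have := hb x hx
      simp only [innerSL_apply_apply] at this
      simp only
      linarith
    exact (h1.closure hd.continuous (by fun_prop)) hx
  · rw [haT]
    have h1 : Set.EqOn (fderiv ℝ u) (fun _ => T) Ω := fun x hx => hT x hx
    exact (h1.closure hd2.continuous continuous_const) hx

/-- Second fundamental form of the boundary tested on the tangential projections of constant
vector fields: the boundary condition becomes an equation for the differential of the unit
normal. -/
theorem IsStaticPotential.smul_fderiv_normal (hu : IsStaticPotential Ω u) (hΩ : IsOpen Ω)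
    (h : IsLocalDefining Ω p U ρ) (hreg : ∀ x ∈ U, gradient ρ x ≠ 0) (hp : p ∈ frontier Ω)
    {N : E n → E n} (hN : N = fun x => ‖gradient ρ x‖⁻¹ • gradient ρ x)
    {w : E n} (hw : ⟪gradient ρ p, w⟫ = 0) :
    u p • fderiv ℝ N p w = fderiv ℝ u p (N p) • w := by
  have hgc := contDiffOn_gradient h.isOpen h.contDiffOn
  have hNc : ContDiffOn ℝ ∞ N U := by
    rw [hN]
    exact ((hgc.norm ℝ hreg).inv fun x hx => norm_ne_zero_iff.2 (hreg x hx)).smul hgc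
  have hN1 : ∀ x ∈ U, ‖N x‖ = 1 := fun x hx => by rw [hN]; exact norm_unit (hreg x hx)
  have hNd : HasFDerivAt N (fderiv ℝ N p) p :=
    ((hNc.contDiffAt (h.isOpen.mem_nhds h.mem)).differentiableAt (by simp)).hasFDerivAt
  have hNw : ⟪N p, w⟫ = 0 := by rw [hN, real_inner_smul_left, hw, mul_zero]
  have hNN : ⟪N p, fderiv ℝ N p w⟫ = 0 := by
    have h1 : (fun x => ⟪N x, N x⟫) =ᶠ[𝓝 p] fun _ => (1 : ℝ) := by
      filter_upwards [h.isOpen.mem_nhds h.mem] with x hx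
      rw [real_inner_self_eq_norm_sq, hN1 x hx, one_pow]
    have h2 := (hNd.inner ℝ hNd).unique
      ((hasFDerivAt_const (1 : ℝ) p).congr_of_eventuallyEq h1)
    have h3 := congrArg (fun T : E n →L[ℝ] ℝ => T w) h2
    simp [fderivInnerCLM_apply] at h3
    rw [real_inner_comm (N p)] at h3
    linarith
  -- Tangential projection of the constant field `v`. As `dN w ⟂ N`, `⟪N, D_w Y⟫ = -⟪v, dN w⟫`, so
  -- `h(w, Y) = ⟪v, dN w⟫`.
  set Y : E n → E n → E n := fun v x => v - ⟪v, N x⟫ • N x with hY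
  have hYt : ∀ v, IsTangentFieldNear Ω p (Y v) := by
    refine fun v => ⟨U, h.isOpen, h.mem,
      contDiffOn_const.sub ((contDiffOn_const.inner ℝ hNc).smul hNc), fun q hq => ?_⟩
    have hq' := h.of_regular hq.1 (hreg q hq.1)
    intro ν hν
    have hνN : ν = N q := by rw [(hq'.isOutwardUnitNormal_iff hΩ hq.2).1 hν, hN]
    rw [hνN, hY, inner_sub_left, real_inner_smul_left, real_inner_self_eq_norm_sq, hN1 q hq.1]
    ring
  have hYw : Y w p = w := by
    simp only [hY]
    rw [real_inner_comm, hNw, zero_smul, sub_zero]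
  refine ext_inner_left ℝ fun v => ?_
  have hYd : HasFDerivAt (Y v) _ p :=
    (((hasFDerivAt_const v p).inner ℝ hNd).smul hNd).const_sub v
  have h2 := hu.boundary_eq p hp (N p)
    ((h.isOutwardUnitNormal_iff hΩ hp).2 (by rw [hN])) (Y w) (Y v) (hYt w) (hYt v)
  rw [secondFundamentalForm, covDeriv, hYw, hYd.fderiv] at h2
  have h3 : ⟪w, Y v p⟫ = ⟪w, v⟫ := by
    simp only [hY]
    rw [inner_sub_right, inner_smul_right, real_inner_comm (N p) w, hNw, mul_zero, sub_zero]
  rw [h3] at h2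
  simp [fderivInnerCLM_apply, inner_add_right, real_inner_smul_right, hNN, hN1 p h.mem] at h2
  rw [real_inner_smul_right, real_inner_smul_right, real_inner_comm w v, h2]

end StaticEquation

/-! ### The boundary near a point -/

section BoundaryParam

variable {n : ℕ} {Ω U : Set (E n)} {ρ : E n → ℝ} {p : E n}

theorem IsLocalDefining.exists_param (h : IsLocalDefining Ω p U ρ)
    (hreg : ∀ x ∈ U, gradient ρ x ≠ 0) (hΩ : IsOpen Ω) (hp : p ∈ frontier Ω) :
    ∃ G : E n → E n, ∃ r > 0, ContDiffOn ℝ 2 G (Metric.ball p r) ∧ G p = p ∧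
      (∀ y ∈ Metric.ball p r, G y ∈ U ∧ G y ∈ frontier Ω ∧
        (∀ a, ⟪gradient ρ (G y), a⟫ = 0 → fderiv ℝ G y a = a) ∧
        ∀ η, ⟪gradient ρ (G y), fderiv ℝ G y η⟫ = 0) ∧
      ∀ V ∈ 𝓝 p, ∀ᶠ x in 𝓝 p, x ∈ frontier Ω → x ∈ G '' V := by
  obtain ⟨G, r, hr, hG, hGp, hGV, hcov⟩ := exists_hypersurface_param h.isOpen h.mem h.contDiffOn
    (h.eq_zero hΩ h.mem hp) h.gradient_ne_zero
  refine ⟨G, r, hr, hG, hGp, fun y hy => ?_, fun V hV => ?_⟩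
  · obtain ⟨h1, h2, h3⟩ := hGV y hy
    have hq := h.of_regular h1 (hreg _ h1)
    refine ⟨h1, hq.mem_frontier hΩ h2, h3, fun η => ?_⟩
    have hGd : HasFDerivAt G (fderiv ℝ G y) y :=
      ((hG.contDiffAt (Metric.isOpen_ball.mem_nhds hy)).differentiableAt (by simp)).hasFDerivAt
    have h4 : (ρ ∘ G) =ᶠ[𝓝 y] fun _ => (0 : ℝ) := by
      filter_upwards [Metric.isOpen_ball.mem_nhds hy] with z hz using (hGV z hz).2.1
    have h5 := (hq.differentiableAt.hasFDerivAt.comp y hGd).unique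
      ((hasFDerivAt_const (0 : ℝ) y).congr_of_eventuallyEq h4)
    rw [inner_gradient_left]
    exact congrArg (fun T : E n →L[ℝ] ℝ => T η) h5
  · filter_upwards [hcov V hV, h.isOpen.mem_nhds h.mem] with x hx hxU hxf
    exact hx (h.eq_zero hΩ hxU hxf)

/-- Otherwise every vector equals its projection to the line of `g` and the dimension is at most
one. It supplies nonzero tangent vectors. -/
theorem exists_ne_zero_inner_eq_zero (hn : 2 ≤ n) (g : E n) : ∃ ξ : E n, ξ ≠ 0 ∧ ⟪g, ξ⟫ = 0 := by
  by_contra! hcon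
  have h1 : Module.finrank ℝ (E n) ≤ 1 := by
    refine finrank_le_one g fun v => ⟨⟪g, v⟫ / ‖g‖ ^ 2, ?_⟩
    by_contra hne
    by_cases hg : g = 0
    · exact hcon v (fun hv => hne (by simp [hv, hg])) (by simp [hg])
    · refine hcon (v - (⟪g, v⟫ / ‖g‖ ^ 2) • g) (sub_ne_zero.2 (Ne.symm hne)) ?_
      have : ‖g‖ ≠ 0 := norm_ne_zero_iff.2 hg
      rw [inner_sub_right, real_inner_smul_right, real_inner_self_eq_norm_sq]
      field_simp
      ring
  rw [finrank_euclideanSpace_fin] at h1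
  omega

/-- The boundary has no isolated points in dimension at least two. -/
theorem IsLocalDefining.frequently_ne (hn : 2 ≤ n) (h : IsLocalDefining Ω p U ρ) (hΩ : IsOpen Ω)
    (hp : p ∈ frontier Ω) : ∃ᶠ x in 𝓝 p, x ∈ frontier Ω ∧ x ≠ p := by
  obtain ⟨V, -, hV, hreg⟩ := h.exists_regular
  obtain ⟨G, r, hr, hG, hGp, hGV, -⟩ := hV.exists_param hreg hΩ hp
  obtain ⟨ξ, hξ, hgξ⟩ := exists_ne_zero_inner_eq_zero hn (gradient ρ p)
  have hpr := Metric.mem_ball_self (x := p) hr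
  have hGc := hG.contDiffAt (Metric.isOpen_ball.mem_nhds hpr)
  have hGξ : fderiv ℝ G p ξ = ξ := (hGV p hpr).2.2.1 ξ (by rwa [hGp])
  have h1 : HasDerivAt (fun t : ℝ => G (p + t • ξ)) ξ 0 := by
    have h2 : HasDerivAt (fun t : ℝ => p + t • ξ) ξ 0 := by
      simpa using ((hasDerivAt_id (0 : ℝ)).smul_const ξ).const_add p
    have h3 : HasFDerivAt G (fderiv ℝ G p) (p + (0 : ℝ) • ξ) := by
      simpa using (hGc.differentiableAt (by simp)).hasFDerivAt
    have h4 := h3.comp_hasDerivAt (0 : ℝ) h2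
    rwa [hGξ] at h4
  have h4 := (h1.eventually_ne (c := p) hξ).filter_mono
    (nhdsWithin_mono (0 : ℝ) (fun t (ht : 0 < t) => ht.ne'))
  have h5 := tendsto_add_smul_nhdsGT_zero p ξ
  have h6 : Tendsto G (𝓝 p) (𝓝 p) := by simpa [ContinuousAt, hGp] using hGc.continuousAt
  refine (h6.comp h5).frequently ?_
  refine Eventually.frequently ?_
  filter_upwards [h4, h5.eventually (Metric.isOpen_ball.mem_nhds hpr)] with t ht1 ht2
  exact ⟨(hGV _ ht2).2.1, ht1⟩

/-- A function whose differential is zero on the tangent spaces of the boundary is locally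
constant on the boundary. -/
theorem IsLocalDefining.eventually_eq (h : IsLocalDefining Ω p U ρ) (hΩ : IsOpen Ω)
    (hp : p ∈ frontier Ω) {ψ : E n → ℝ} (hψ : Differentiable ℝ ψ)
    (h0 : ∀ q ∈ frontier Ω, ∀ v, IsTangentAt Ω q v → fderiv ℝ ψ q v = 0) :
    ∀ᶠ x in 𝓝 p, x ∈ frontier Ω → ψ x = ψ p := by
  obtain ⟨V, -, hV, hreg⟩ := h.exists_regular
  obtain ⟨G, r, hr, hG, hGp, hGV, hcov⟩ := hV.exists_param hreg hΩ hp
  have hpr := Metric.mem_ball_self (x := p) hr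
  have hGd := hG.differentiableOn (by simp)
  have hconst := Metric.isOpen_ball.exists_is_const_of_fderiv_eq_zero (f := ψ ∘ G)
    (convex_ball p r).isPreconnected (hψ.comp_differentiableOn hGd) (fun y hy => by
      have hGy := (hGd.differentiableAt (Metric.isOpen_ball.mem_nhds hy)).hasFDerivAt
      rw [((hψ (G y)).hasFDerivAt.comp y hGy).fderiv]
      ext η
      obtain ⟨h1, h2, -, h4⟩ := hGV y hy
      exact h0 _ h2 _ (((hV.of_regular h1 (hreg _ h1)).isTangentAt_iff hΩ h2).2 (h4 η)))
  obtain ⟨b, hb⟩ := hconst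
  filter_upwards [hcov _ (Metric.ball_mem_nhds p hr)] with x hx hxf
  obtain ⟨y, hy, rfl⟩ := hx hxf
  have h1 := hb y hy
  have h2 := hb p hpr
  simp only [Function.comp, hGp] at h1 h2
  rw [h1, h2]

/-- Near each of its points, the boundary of a domain with a static potential has a unit normal
that is an affine function of the position. -/
theorem IsStaticPotential.eventually_normal_eq {u : E n → ℝ} (hn : 2 ≤ n)
    (hu : IsStaticPotential Ω u) (hΩ : IsSmoothDomain Ω) (hp : p ∈ frontier Ω) :
    ∃ z : ℝ × E n, ∀ᶠ x in 𝓝 p, x ∈ frontier Ω →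
      ∀ ν, IsOutwardUnitNormal Ω x ν → ν = z.1 • x + z.2 := by
  obtain ⟨a, b, hab⟩ := hu.exists_affine hn hΩ
  obtain ⟨U, ρ, h⟩ := hΩ.exists_localDefining p hp
  obtain ⟨V, -, hV, hreg⟩ := h.exists_regular
  obtain ⟨G, r, hr, hG, hGp, hGV, hcov⟩ := hV.exists_param hreg hΩ.isOpen hp
  set N : E n → E n := fun x => ‖gradient ρ x‖⁻¹ • gradient ρ x with hN
  have hgc := contDiffOn_gradient hV.isOpen hV.contDiffOn
  have hNc : ContDiffOn ℝ ∞ N V :=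
    ((hgc.norm ℝ hreg).inv fun x hx => norm_ne_zero_iff.2 (hreg x hx)).smul hgc
  have h2inf : (2 : WithTop ℕ∞) ≤ ∞ := WithTop.coe_le_coe.2 (le_top : (2 : ℕ∞) ≤ ⊤)
  have hpr := Metric.mem_ball_self (x := p) hr
  obtain ⟨ξ, hξ, hgξ⟩ := exists_ne_zero_inner_eq_zero hn (gradient ρ p)
  have hξev : ∀ᶠ y in 𝓝 p, fderiv ℝ G y ξ ≠ 0 := by
    have h1 : ContinuousOn (fun y => fderiv ℝ G y ξ) (Metric.ball p r) :=
      (hG.continuousOn_fderiv_of_isOpen Metric.isOpen_ball (by norm_num)).clm_apply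
        continuousOn_const
    refine (h1.continuousAt (Metric.isOpen_ball.mem_nhds hpr)).eventually_ne ?_
    rw [(hGV p hpr).2.2.1 ξ (by rwa [hGp])]
    exact hξ
  obtain ⟨s, hs, hball⟩ := Metric.eventually_nhds_iff_ball.1
    (hξev.and (Metric.isOpen_ball.mem_nhds hpr))
  have hsr : Metric.ball p s ⊆ Metric.ball p r := fun y hy => (hball y hy).2
  have hGs := hG.mono hsr
  have hNs : ContDiffOn ℝ 2 (N ∘ G) (Metric.ball p s) :=
    (hNc.of_le h2inf).comp hGs fun y hy => (hGV y (hsr hy)).1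
  obtain ⟨c, v, hcv⟩ := exists_eq_smul_add_of_umbilic hGs hNs a b
    (fun y hy η => by
      obtain ⟨h1, h2, h3, h4⟩ := hGV y (hsr hy)
      have hGy : HasFDerivAt G (fderiv ℝ G y) y :=
        ((hGs.contDiffAt (Metric.isOpen_ball.mem_nhds hy)).differentiableAt (by simp)).hasFDerivAt
      have hNy : HasFDerivAt N (fderiv ℝ N (G y)) (G y) :=
        ((hNc.contDiffAt (hV.isOpen.mem_nhds h1)).differentiableAt (by simp)).hasFDerivAt
      have h5 := hu.smul_fderiv_normal hΩ.isOpen (hV.of_regular h1 (hreg _ h1)) hreg h2 hN (h4 η)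
      obtain ⟨h6, h7⟩ := hab (G y) (frontier_subset_closure h2)
      rw [h6, h7] at h5
      rw [(hNy.comp y hGy).fderiv]
      exact h5)
    (fun y hy hy0 => by
      obtain ⟨h1, h2, h3, h4⟩ := hGV y (hsr hy)
      obtain ⟨h6, h7⟩ := hab (G y) (frontier_subset_closure h2)
      have hd := hV.of_regular h1 (hreg _ h1)
      have h8 : a ≠ 0 := by
        rintro rfl
        obtain ⟨x, hx, hux⟩ := hu.nontrivial
        have := (hab x (subset_closure hx)).1
        simp only [inner_zero_left, zero_add] at this hy0
        exact hux (this.trans hy0)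
      -- At a zero of `u` the boundary equation, tested on the nonzero tangent vector `dG ξ`, gives
      -- `⟪a, N⟫ = 0`. So `a` is tangent and `dG a = a`.
      have h9 : ⟪gradient ρ (G y), a⟫ = 0 := by
        have h10 := hu.smul_fderiv_normal hΩ.isOpen hd hreg h2 hN (h4 ξ)
        rw [h6, hy0, zero_smul, h7] at h10
        have h11 := (smul_eq_zero.1 h10.symm).resolve_right (hball y hy).1
        rw [innerSL_apply_apply, hN, real_inner_smul_right, real_inner_comm] at h11
        exact (mul_eq_zero.1 h11).resolve_left (inv_ne_zero (norm_ne_zero_iff.2 (hreg _ h1)))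
      exact ⟨a, by rw [h3 a h9]; exact (real_inner_self_pos.2 h8).ne'⟩)
    ξ (fun y hy => (hball y hy).1)
  refine ⟨(c, v), ?_⟩
  filter_upwards [hcov _ (Metric.ball_mem_nhds p hs)] with x hx hxf ν hν
  obtain ⟨y, hy, rfl⟩ := hx hxf
  obtain ⟨h1, h2, h3, h4⟩ := hGV y (hsr hy)
  rw [((hV.of_regular h1 (hreg _ h1)).isOutwardUnitNormal_iff hΩ.isOpen h2).1 hν]
  exact hcv y hy

end BoundaryParam

end EuclStatic

/-! ### From local to global -/

namespace EuclStatic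

open Filter Topology

/-- On a preconnected set, a family of local conditions whose index is locally determined holds
globally for a single index. -/
theorem _root_.IsPreconnected.exists_forall_of_eventually {X ι : Type*} [TopologicalSpace X]
    {S : Set X} (hS : IsPreconnected S) (hne : S.Nonempty) (P : ι → X → Prop)
    (hex : ∀ p ∈ S, ∃ i, ∀ᶠ x in 𝓝 p, x ∈ S → P i x)
    (huniq : ∀ p ∈ S, ∀ i j, (∀ᶠ x in 𝓝 p, x ∈ S → P i x) → (∀ᶠ x in 𝓝 p, x ∈ S → P j x) → i = j) :
    ∃ i, ∀ x ∈ S, P i x := by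
  obtain ⟨p, hp⟩ := hne
  obtain ⟨i, hi⟩ := hex p hp
  have hopen : ∀ j, IsOpen {q | ∀ᶠ x in 𝓝 q, x ∈ S → P j x} := fun j => isOpen_iff_mem_nhds.2
    fun q hq => eventually_eventually_nhds.2 hq
  have hcov : S ⊆ {q | ∀ᶠ x in 𝓝 q, x ∈ S → P i x} ∪
      ⋃ j ∈ ({i}ᶜ : Set ι), {q | ∀ᶠ x in 𝓝 q, x ∈ S → P j x} := fun q hq => by
    obtain ⟨j, hj⟩ := hex q hq
    by_cases hji : j = i
    · exact Or.inl (hji ▸ hj)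
    · exact Or.inr (Set.mem_iUnion₂.2 ⟨j, hji, hj⟩)
  have hdisj : S ∩ ({q | ∀ᶠ x in 𝓝 q, x ∈ S → P i x} ∩
      ⋃ j ∈ ({i}ᶜ : Set ι), {q | ∀ᶠ x in 𝓝 q, x ∈ S → P j x}) = ∅ := by
    refine Set.eq_empty_of_forall_notMem fun q ⟨hq, hqi, hqj⟩ => ?_
    obtain ⟨j, hj, hqj⟩ := Set.mem_iUnion₂.1 hqj
    exact hj (huniq q hq j i hqj hqi)
  refine ⟨i, ?_⟩
  rcases isPreconnected_iff_subset_of_disjoint.1 hS _ _ (hopen i)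
    (isOpen_biUnion fun j _ => hopen j) hcov hdisj with h | h
  · exact fun x hx => (h hx).self_of_nhds hx
  · obtain ⟨j, hj, hpj⟩ := Set.mem_iUnion₂.1 (h hp)
    exact absurd (huniq p hp j i hpj hi) hj

section Classification

variable {n : ℕ} {Ω : Set (E n)}

/-- Two affine formulas valid near `p` agree at `p` and at some other boundary point, since `p` is
not isolated; this already determines `c`, then `v`. Connectedness does the rest. -/
theorem IsSimpleNonGeneric.exists_normal_eq (hn : 2 ≤ n) (h : IsSimpleNonGeneric Ω) :
    ∃ (c : ℝ) (v : E n), ∀ x ∈ frontier Ω, ∀ ν, IsOutwardUnitNormal Ω x ν → ν = c • x + v := by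
  obtain ⟨u, hu⟩ := h.exists_staticPotential
  have hΩ := h.toIsSmoothDomain
  obtain ⟨z, hz⟩ := h.isConnected_frontier.isPreconnected.exists_forall_of_eventually
    h.isConnected_frontier.nonempty
    (fun (z : ℝ × E n) x => ∀ ν, IsOutwardUnitNormal Ω x ν → ν = z.1 • x + z.2)
    (fun p hp => hu.eventually_normal_eq hn hΩ hp) (fun p hp z z' hz hz' => by
      have key : ∀ᶠ x in 𝓝 p, x ∈ frontier Ω → z.1 • x + z.2 = z'.1 • x + z'.2 := by
        filter_upwards [hz, hz'] with x hx hx' hxf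
        obtain ⟨U, ρ, hd⟩ := hΩ.exists_localDefining x hxf
        exact (hx hxf _ ⟨U, ρ, hd, rfl⟩).symm.trans (hx' hxf _ ⟨U, ρ, hd, rfl⟩)
      have hp1 := key.self_of_nhds hp
      obtain ⟨U, ρ, hd⟩ := hΩ.exists_localDefining p hp
      obtain ⟨x, ⟨hxf, hxp⟩, hx⟩ := ((hd.frequently_ne hn hΩ.isOpen hp).and_eventually key).exists
      have hx1 := hx hxf
      have h1 : (z.1 - z'.1) • (x - p) = 0 := by
        have : (z.1 - z'.1) • (x - p) =
          (z.1 • x + z.2 - (z'.1 • x + z'.2)) - (z.1 • p + z.2 - (z'.1 • p + z'.2)) := by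
          module
        rw [this, hx1, hp1, sub_self, sub_self, sub_zero]
      have h2 : z.1 = z'.1 :=
        sub_eq_zero.1 ((smul_eq_zero.1 h1).resolve_right (sub_ne_zero.2 hxp))
      rw [h2] at hp1
      exact Prod.ext h2 (add_left_cancel hp1))
  exact ⟨z.1, z.2, hz⟩

/-- If the boundary of a smooth domain lies in a set `S` that separates the space into two
connected pieces both of which accumulate everywhere on `S`, then it is all of `S`. -/
theorem IsSmoothDomain.frontier_eq_of_subset (hΩ : IsSmoothDomain Ω) (hne : (frontier Ω).Nonempty)
    {S A B : Set (E n)} (hS : frontier Ω ⊆ S) (hA : IsPreconnected A) (hB : IsPreconnected B)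
    (hAS : Disjoint A S) (hBS : Disjoint B S) (hcov : ∀ x, x ∈ S ∨ x ∈ A ∨ x ∈ B)
    (hSA : S ⊆ closure A) (hSB : S ⊆ closure B) : frontier Ω = S := by
  -- `C` misses the frontier, so it lies in `Ω` or in the complement of its closure.
  have hside : ∀ {C : Set (E n)}, IsPreconnected C → Disjoint C S → (C ∩ Ω).Nonempty → C ⊆ Ω := by
    intro C hC hCS hCΩ
    have h1 : C ⊆ Ω ∪ (closure Ω)ᶜ := fun x hx => by
      by_contra hcon
      simp only [Set.mem_union, Set.mem_compl_iff, not_or, not_not] at hcon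
      exact Set.disjoint_left.1 hCS hx (hS (by
        rw [hΩ.isOpen.frontier_eq]; exact ⟨hcon.2, hcon.1⟩))
    have h2 : C ∩ (Ω ∩ (closure Ω)ᶜ) = ∅ :=
      Set.eq_empty_of_forall_notMem fun x hx => hx.2.2 (subset_closure hx.2.1)
    rcases isPreconnected_iff_subset_of_disjoint.1 hC _ _ hΩ.isOpen
      isClosed_closure.isOpen_compl h1 h2 with h | h
    · exact h
    · obtain ⟨x, hxC, hxΩ⟩ := hCΩ
      exact absurd (subset_closure hxΩ) (h hxC)
  have hint : ∀ {W : Set (E n)}, IsOpen W → W ⊆ S → ¬ W.Nonempty := by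
    rintro W hW hWS ⟨x, hx⟩
    obtain ⟨z, hzW, hzA⟩ := mem_closure_iff.1 (hSA (hWS hx)) W hW hx
    exact Set.disjoint_left.1 hAS hzA (hWS hzW)
  refine hS.antisymm fun q hq => ?_
  by_contra hqf
  by_cases hqΩ : q ∈ Ω
  -- Both sides then lie in `Ω`, so the nonempty open set `ρ > 0` near a boundary point is contained
  -- in `S`, which has empty interior.
  · have h1 : A ⊆ Ω := hside hA hAS (by
      rw [Set.inter_comm]; exact mem_closure_iff.1 (hSA hq) Ω hΩ.isOpen hqΩ)
    have h2 : B ⊆ Ω := hside hB hBS (by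
      rw [Set.inter_comm]; exact mem_closure_iff.1 (hSB hq) Ω hΩ.isOpen hqΩ)
    obtain ⟨p, hp⟩ := hne
    obtain ⟨U, ρ, hd⟩ := hΩ.exists_localDefining p hp
    have h3 := frequently_pos_of_gradient_ne_zero hd.gradient_ne_zero
      (hd.eq_zero hΩ.isOpen hd.mem hp)
    obtain ⟨x, hx, hxU⟩ := (h3.and_eventually (hd.isOpen.mem_nhds hd.mem)).exists
    refine hint (hd.contDiffOn.continuousOn.isOpen_inter_preimage hd.isOpen isOpen_Ioi)
      (fun y hy => ?_) ⟨x, hxU, hx⟩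
    have hyΩ : y ∉ Ω := fun hyΩ => lt_asymm ((hd.mem_iff y hy.1).1 hyΩ) hy.2
    rcases hcov y with h | h | h
    · exact h
    · exact absurd (h1 h) hyΩ
    · exact absurd (h2 h) hyΩ
  -- Here neither side meets `Ω`, so the open set `Ω` itself would lie in `S`.
  · have hqc : q ∈ (closure Ω)ᶜ := fun hqc => hqf (by
      rw [hΩ.isOpen.frontier_eq]; exact ⟨hqc, hqΩ⟩)
    have hdisj : ∀ {C : Set (E n)}, IsPreconnected C → Disjoint C S → S ⊆ closure C →
        ∀ x ∈ C, x ∉ Ω := by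
      intro C hC hCS hSC x hxC hxΩ
      obtain ⟨z, hz, hzC⟩ := mem_closure_iff.1 (hSC hq) _ isClosed_closure.isOpen_compl hqc
      exact hz (subset_closure (hside hC hCS ⟨x, hxC, hxΩ⟩ hzC))
    refine hint hΩ.isOpen (fun y hy => ?_) hΩ.isConnected.nonempty
    rcases hcov y with h | h | h
    · exact h
    · exact absurd hy (hdisj hA hAS hSA y h)
    · exact absurd hy (hdisj hB hBS hSB y h)

end Classification

/-! ### Spheres, hyperplanes and their complements -/

section Topology

theorem one_lt_rank {n : ℕ} (hn : 2 ≤ n) : 1 < Module.rank ℝ (E n) := by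
  rw [← Module.finrank_eq_rank, finrank_euclideanSpace_fin]
  exact_mod_cast hn

/-- In dimension at least two, the exterior of a ball is connected. -/
theorem isConnected_compl_closedBall {n : ℕ} (hn : 2 ≤ n) (c : E n) {r : ℝ} (hr : 0 < r) :
    IsConnected (Metric.closedBall c r)ᶜ := by
  have h1 : IsConnected (Set.Ioi r ×ˢ Metric.sphere (0 : E n) 1) :=
    isConnected_Ioi.prod (isConnected_sphere (one_lt_rank hn) 0 zero_le_one)
  have h2 : (Metric.closedBall c r)ᶜ =
      (fun z : ℝ × E n => c + z.1 • z.2) '' (Set.Ioi r ×ˢ Metric.sphere (0 : E n) 1) := by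
    ext x
    simp only [Set.mem_compl_iff, Metric.mem_closedBall, not_le, Set.mem_image, Set.mem_prod,
      Set.mem_Ioi, mem_sphere_zero_iff_norm, Prod.exists, dist_eq_norm]
    constructor
    · intro hx
      have h0 : ‖x - c‖ ≠ 0 := (hr.trans hx).ne'
      refine ⟨‖x - c‖, ‖x - c‖⁻¹ • (x - c), ⟨hx, norm_unit (norm_ne_zero_iff.1 h0)⟩, ?_⟩
      rw [smul_smul, mul_inv_cancel₀ h0, one_smul]
      abel
    · rintro ⟨t, y, ⟨ht, hy⟩, rfl⟩
      rw [add_sub_cancel_left, norm_smul, hy, mul_one, Real.norm_of_nonneg (hr.trans ht).le]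
      exact ht
  rw [h2]
  exact h1.image _ (by fun_prop)

theorem hasGradientAt_inner_sub {n : ℕ} (a : E n) (b ε : ℝ) (x : E n) :
    HasGradientAt (fun x => ε * (⟪a, x⟫ - b)) (ε • a) x := by
  have h : HasFDerivAt (fun x : E n => ⟪a, x⟫) (innerSL ℝ a) x := (innerSL ℝ a).hasFDerivAt
  rw [hasGradientAt_iff_hasFDerivAt]
  convert! (h.sub_const b).const_mul ε
  ext v
  simp

theorem hasGradientAt_norm_sq_sub {n : ℕ} (c : E n) (r ε : ℝ) (x : E n) :
    HasGradientAt (fun x => ε * (‖x - c‖ ^ 2 - r ^ 2) / 2) (ε • (x - c)) x := by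
  have h := (((((hasFDerivAt_id x).sub_const c).norm_sq).sub_const (r ^ 2)).const_mul
    ε).mul_const (2 : ℝ)⁻¹
  rw [hasGradientAt_iff_hasFDerivAt]
  simp only [div_eq_mul_inv]
  convert! h
  ext v
  simp
  ring

theorem frontier_sublevel {n : ℕ} {ρ : E n → ℝ} (hρ : Continuous ρ)
    (hreg : ∀ x, ρ x = 0 → gradient ρ x ≠ 0) : frontier {x | ρ x < 0} = {x | ρ x = 0} := by
  refine (frontier_lt_subset_eq hρ continuous_const).antisymm fun x hx => ?_
  rw [(isOpen_lt hρ continuous_const).frontier_eq]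
  exact ⟨mem_closure_iff_frequently.2 (frequently_neg_of_gradient_ne_zero (hreg x hx) hx),
    fun h => absurd hx (ne_of_lt h)⟩

theorem frontier_halfSpace {n : ℕ} {a : E n} (ha : a ≠ 0) (b : ℝ) {ε : ℝ} (hε : ε ≠ 0) :
    frontier {x : E n | ε * (⟪a, x⟫ - b) < 0} = {x | ⟪a, x⟫ = b} := by
  rw [frontier_sublevel (by fun_prop) fun x _ => by
    rw [(hasGradientAt_inner_sub a b ε x).gradient]
    exact smul_ne_zero hε ha]
  ext x
  simp [hε, sub_eq_zero]

theorem halfSpace_lt_eq {n : ℕ} (a : E n) (b : ℝ) :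
    {x : E n | ⟪a, x⟫ < b} = {x | (1 : ℝ) * (⟪a, x⟫ - b) < 0} := by
  ext x; simp

theorem halfSpace_gt_eq {n : ℕ} (a : E n) (b : ℝ) :
    {x : E n | b < ⟪a, x⟫} = {x | (-1 : ℝ) * (⟪a, x⟫ - b) < 0} := by
  ext x; simp

theorem convex_halfSpace_inner_lt {n : ℕ} (a : E n) (b : ℝ) : Convex ℝ {x : E n | ⟪a, x⟫ < b} :=
  convex_halfSpace_lt (innerSL ℝ a).isLinear b

theorem convex_halfSpace_inner_gt {n : ℕ} (a : E n) (b : ℝ) : Convex ℝ {x : E n | b < ⟪a, x⟫} :=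
  convex_halfSpace_gt (innerSL ℝ a).isLinear b

end Topology

/-! ### Classification -/

/-- The boundary of a simple non-generic domain is a round sphere or a hyperplane. -/
theorem IsSimpleNonGeneric.frontier_eq {n : ℕ} {Ω : Set (E n)} (hn : 2 ≤ n)
    (h : IsSimpleNonGeneric Ω) :
    (∃ (c : E n) (r : ℝ), 0 < r ∧ frontier Ω = Metric.sphere c r) ∨
      ∃ (a : E n) (b : ℝ), a ≠ 0 ∧ frontier Ω = {x | ⟪a, x⟫ = b} := by
  have hΩ := h.toIsSmoothDomain
  have hne := h.isConnected_frontier.nonempty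
  obtain ⟨c, v, hcv⟩ := h.exists_normal_eq hn
  have hnorm : ∀ x ∈ frontier Ω, ‖c • x + v‖ = 1 := by
    intro x hx
    obtain ⟨U, ρ, hd⟩ := hΩ.exists_localDefining x hx
    rw [← hcv x hx _ ⟨U, ρ, hd, rfl⟩]
    exact norm_unit hd.gradient_ne_zero
  by_cases hc : c = 0
  · right
    subst hc
    simp only [zero_smul, zero_add] at hcv hnorm
    obtain ⟨p, hp⟩ := hne
    have hv : v ≠ 0 := norm_ne_zero_iff.1 (by rw [hnorm p hp]; exact one_ne_zero)
    obtain ⟨b, hb⟩ := h.isConnected_frontier.isPreconnected.exists_forall_of_eventually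
      ⟨p, hp⟩ (fun (b : ℝ) x => ⟪v, x⟫ = b) (fun q hq => by
        obtain ⟨U, ρ, hd⟩ := hΩ.exists_localDefining q hq
        refine ⟨⟪v, q⟫, hd.eventually_eq hΩ.isOpen hq (ψ := innerSL ℝ v)
          (innerSL ℝ v).differentiable fun x hx w hw => ?_⟩
        obtain ⟨U', ρ', hd'⟩ := hΩ.exists_localDefining x hx
        have h1 : IsOutwardUnitNormal Ω x v :=
          ⟨U', ρ', hd', (hcv x hx _ ⟨U', ρ', hd', rfl⟩).symm⟩
        rw [ContinuousLinearMap.fderiv, innerSL_apply_apply, real_inner_comm]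
        exact hw v h1)
      (fun q hq b b' hb hb' => (hb.self_of_nhds hq).symm.trans (hb'.self_of_nhds hq))
    refine ⟨v, b, hv, hΩ.frontier_eq_of_subset ⟨p, hp⟩ hb
      (convex_halfSpace_inner_lt v b).isPreconnected (convex_halfSpace_inner_gt v b).isPreconnected
      (Set.disjoint_left.2 fun x hx hx' => hx.ne hx')
      (Set.disjoint_left.2 fun x hx hx' => hx.ne' hx')
      (fun x => ?_) ?_ ?_⟩
    · rcases lt_trichotomy ⟪v, x⟫ b with h | h | h
      · exact Or.inr (Or.inl h)
      · exact Or.inl h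
      · exact Or.inr (Or.inr h)
    · rw [halfSpace_lt_eq, ← frontier_halfSpace hv b one_ne_zero]
      exact frontier_subset_closure
    · rw [halfSpace_gt_eq, ← frontier_halfSpace hv b (neg_ne_zero.2 one_ne_zero)]
      exact frontier_subset_closure
  · left
    have hr : 0 < |c|⁻¹ := by positivity
    -- Centre and radius read off from `‖c • x + v‖ = 1`.
    refine ⟨-(c⁻¹ • v), |c|⁻¹, hr, hΩ.frontier_eq_of_subset hne (fun x hx => ?_)
      (convex_ball _ |c|⁻¹).isPreconnected (isConnected_compl_closedBall hn _ hr).isPreconnected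
      (Set.disjoint_left.2 fun x hx hx' => (Metric.mem_ball.1 hx).ne hx')
      (Set.disjoint_left.2 fun x hx hx' => hx (Metric.sphere_subset_closedBall hx'))
      (fun x => ?_) ?_ ?_⟩
    · have h1 : x - -(c⁻¹ • v) = c⁻¹ • (c • x + v) := by
        rw [smul_add, smul_smul, inv_mul_cancel₀ hc, one_smul, sub_neg_eq_add]
      rw [mem_sphere_iff_norm, h1, norm_smul, hnorm x hx, mul_one, norm_inv, Real.norm_eq_abs]
    · simp only [Metric.mem_sphere, Metric.mem_ball, Set.mem_compl_iff, Metric.mem_closedBall,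
        not_le]
      rcases lt_trichotomy (dist x (-(c⁻¹ • v))) |c|⁻¹ with h | h | h
      · exact Or.inr (Or.inl h)
      · exact Or.inl h
      · exact Or.inr (Or.inr h)
    · rw [closure_ball _ hr.ne']
      exact Metric.sphere_subset_closedBall
    · rw [← frontier_closedBall _ hr.ne', ← frontier_compl]
      exact frontier_subset_closure

/-! ### The model domains -/

/-- A connected sublevel set whose defining function has an affine gradient field with linear part
a multiple `l` of the identity is non-generic as soon as there is an affine function `u` with
`⟪∇u, ∇ρ⟫ = l u` on the boundary. -/
theorem isSimpleNonGeneric_sublevel {n : ℕ} (hn : 2 ≤ n) {ρ : E n → ℝ} (hρ : ContDiff ℝ ∞ ρ)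
    (hconn : IsConnected {x | ρ x < 0}) (hconn' : IsConnected {x | ρ x = 0}) {l : ℝ} {g : E n}
    (hgrad : ∀ x, gradient ρ x = l • x + g) (hreg : ∀ x, ρ x = 0 → gradient ρ x ≠ 0)
    {a : E n} {b : ℝ} (hbd : ∀ x, ρ x = 0 → ⟪a, gradient ρ x⟫ = l * (⟪a, x⟫ + b))
    (hne : ∃ x, ρ x < 0 ∧ ⟪a, x⟫ + b ≠ 0) : IsSimpleNonGeneric {x | ρ x < 0} := by
  have hfr := frontier_sublevel hρ.continuous hreg
  have hopen : IsOpen {x | ρ x < 0} := isOpen_lt hρ.continuous continuous_const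
  have hdef : ∀ p, ρ p = 0 → IsLocalDefining {x | ρ x < 0} p Set.univ ρ := fun p hp =>
    ⟨isOpen_univ, Set.mem_univ p, hρ.contDiffOn, hreg p hp, fun x _ => Iff.rfl⟩
  have hud : ∀ x, HasFDerivAt (fun x : E n => ⟪a, x⟫ + b) (innerSL ℝ a) x := fun x =>
    (innerSL ℝ a).hasFDerivAt.add_const b
  have hfu : fderiv ℝ (fun x : E n => ⟪a, x⟫ + b) = fun _ => innerSL ℝ a :=
    funext fun x => (hud x).fderiv
  refine ⟨⟨⟨hopen, hconn, fun p hp => ⟨Set.univ, ρ, hdef p (by rwa [hfr] at hp)⟩⟩,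
    fun x => ⟪a, x⟫ + b, ?_, hne, fun p _ => ?_, fun p hp ν hν X Y hX hY => ?_⟩,
    by rwa [hfr]⟩
  · exact (contDiff_const.inner ℝ contDiff_id).add contDiff_const
  · refine (lstar_eq_zero_iff hn).2 fun v w => ?_
    rw [hess, iteratedFDeriv_two_apply, hfu]
    simp
  · have hp0 : ρ p = 0 := by rwa [hfr] at hp
    have hd := hdef p hp0
    obtain ⟨V, hVo, hpV, hYc, hYt⟩ := hY
    obtain ⟨W, -, hpW, -, hXt⟩ := hX
    have hXp := (hd.isTangentAt_iff hopen hp).1 (hXt p ⟨hpW, hp⟩)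
    have hYd : HasFDerivAt Y (fderiv ℝ Y p) p :=
      ((hYc.contDiffAt (hVo.mem_nhds hpV)).differentiableAt (by simp)).hasFDerivAt
    have hgd : HasFDerivAt (fun x : E n => l • x + g) (l • ContinuousLinearMap.id ℝ (E n)) p :=
      ((hasFDerivAt_id p).const_smul l).add_const g
    have hψ := hgd.inner ℝ hYd
    -- `⟪∇ρ, Y⟫` vanishes on the boundary; its derivative along `X` gives `l⟪X, Y⟫ + ⟪∇ρ, D_X Y⟫ =
    -- 0`.
    have h1 := hd.fderiv_eq_zero_of_tangent hopen hp hψ.differentiableAt (by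
      filter_upwards [hVo.mem_nhds hpV] with x hx hxf
      rw [← hgrad]
      exact ((hdef x (by rwa [hfr] at hxf)).isTangentAt_iff hopen hxf).1 (hYt x ⟨hx, hxf⟩)) hXp
    rw [hψ.fderiv] at h1
    simp only [ContinuousLinearMap.comp_apply, ContinuousLinearMap.prod_apply,
      fderivInnerCLM_apply, smul_apply, ContinuousLinearMap.id_apply, real_inner_smul_left,
      ← hgrad] at h1
    rw [(hd.isOutwardUnitNormal_iff hopen hp).1 hν, secondFundamentalForm, covDeriv, hfu,
      innerSL_apply_apply, real_inner_smul_right, hbd p hp0, real_inner_smul_left]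
    linear_combination ((⟪a, p⟫ + b) * ‖gradient ρ p‖⁻¹) * h1

/-- The potential is `⟪e, x - c⟫` for any `e ≠ 0`; the sign of `ε` selects the side. As it vanishes
at the centre, `hne` provides a point `c + t • e` with `t ≠ 0`. -/
theorem isSimpleNonGeneric_round {n : ℕ} (hn : 2 ≤ n) (c : E n) {r ε : ℝ} (hr : 0 < r)
    (hε : ε ≠ 0) (hconn : IsConnected {x : E n | ε * (‖x - c‖ ^ 2 - r ^ 2) / 2 < 0})
    (hne : ∀ e : E n, e ≠ 0 → ∃ t ≠ (0 : ℝ), ε * (‖t • e‖ ^ 2 - r ^ 2) / 2 < 0) :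
    IsSimpleNonGeneric {x : E n | ε * (‖x - c‖ ^ 2 - r ^ 2) / 2 < 0} := by
  obtain ⟨e, he, -⟩ := exists_ne_zero_inner_eq_zero hn (0 : E n)
  have hz : {x : E n | ε * (‖x - c‖ ^ 2 - r ^ 2) / 2 = 0} = Metric.sphere c r := by
    ext x
    simp only [Set.mem_ofPred_eq, mem_sphere_iff_norm, div_eq_zero_iff, mul_eq_zero, hε, false_or,
      OfNat.ofNat_ne_zero, or_false, sub_eq_zero]
    exact sq_eq_sq₀ (norm_nonneg _) hr.le
  have hg := fun x => (hasGradientAt_norm_sq_sub c r ε x).gradient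
  refine isSimpleNonGeneric_sublevel hn (l := ε) (g := -(ε • c)) (a := e) (b := -⟪e, c⟫) ?_ hconn
    ?_ (fun x => ?_) (fun x hx => ?_) (fun x hx => ?_) ?_
  · exact (contDiff_const.mul (((contDiff_id.sub contDiff_const).norm_sq ℝ).sub
      contDiff_const)).div_const 2
  · rw [hz]
    exact isConnected_sphere (one_lt_rank hn) c hr.le
  · rw [hg, smul_sub, sub_eq_add_neg]
  · rw [hg]
    have hx' : x ∈ Metric.sphere c r := hz ▸ hx
    refine smul_ne_zero hε (norm_ne_zero_iff.1 ?_)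
    rw [mem_sphere_iff_norm.1 hx']
    exact hr.ne'
  · rw [hg, real_inner_smul_right, inner_sub_right]
    ring
  · obtain ⟨t, ht, hte⟩ := hne e he
    refine ⟨c + t • e, by simpa using hte, ?_⟩
    rw [inner_add_right, real_inner_smul_right]
    have := real_inner_self_pos.2 he
    have h1 : ⟪e, c⟫ + t * ⟪e, e⟫ + -⟪e, c⟫ = t * ⟪e, e⟫ := by ring
    rw [h1]
    exact mul_ne_zero ht this.ne'

theorem isSimpleNonGeneric_ball {n : ℕ} (hn : 2 ≤ n) (c : E n) {r : ℝ} (hr : 0 < r) :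
    IsSimpleNonGeneric (Metric.ball c r) := by
  have h : Metric.ball c r = {x : E n | (1 : ℝ) * (‖x - c‖ ^ 2 - r ^ 2) / 2 < 0} := by
    ext x
    rw [mem_ball_iff_norm, Set.mem_ofPred_eq, ← sq_lt_sq₀ (norm_nonneg _) hr.le]
    constructor <;> intro h <;> linarith
  rw [h]
  refine isSimpleNonGeneric_round hn c hr one_ne_zero ?_ fun e he => ?_
  · rw [← h]
    exact (Metric.isConnected_ball hr)
  · have h0 := norm_pos_iff.2 he
    refine ⟨r / 2 / ‖e‖, by positivity, ?_⟩
    rw [norm_smul, Real.norm_of_nonneg (by positivity), div_mul_cancel₀ _ h0.ne']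
    nlinarith

theorem isSimpleNonGeneric_compl_closedBall {n : ℕ} (hn : 2 ≤ n) (c : E n) {r : ℝ} (hr : 0 < r) :
    IsSimpleNonGeneric (Metric.closedBall c r)ᶜ := by
  have h : (Metric.closedBall c r)ᶜ = {x : E n | (-1 : ℝ) * (‖x - c‖ ^ 2 - r ^ 2) / 2 < 0} := by
    ext x
    rw [Set.mem_compl_iff, mem_closedBall_iff_norm, not_le, Set.mem_ofPred_eq,
      ← sq_lt_sq₀ hr.le (norm_nonneg _)]
    constructor <;> intro h <;> linarith
  rw [h]
  refine isSimpleNonGeneric_round hn c hr (neg_ne_zero.2 one_ne_zero) ?_ fun e he => ?_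
  · rw [← h]
    exact isConnected_compl_closedBall hn c hr
  · have h0 := norm_pos_iff.2 he
    refine ⟨2 * r / ‖e‖, by positivity, ?_⟩
    rw [norm_smul, Real.norm_of_nonneg (by positivity), div_mul_cancel₀ _ h0.ne']
    nlinarith

theorem isSimpleNonGeneric_halfSpace {n : ℕ} (hn : 2 ≤ n) {a : E n} (ha : a ≠ 0) (b : ℝ) {ε : ℝ}
    (hε : ε ≠ 0) (hconv : Convex ℝ {x : E n | ε * (⟪a, x⟫ - b) < 0}) :
    IsSimpleNonGeneric {x : E n | ε * (⟪a, x⟫ - b) < 0} := by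
  have hg := fun x => (hasGradientAt_inner_sub a b ε x).gradient
  have haa := (real_inner_self_pos.2 ha).ne'
  have hpt : ∀ s : ℝ, ⟪a, (s / ⟪a, a⟫) • a⟫ = s := fun s => by
    rw [real_inner_smul_right, div_mul_cancel₀ _ haa]
  -- At this point the defining function equals `-ε²`.
  have hne : ε * (⟪a, ((b - ε) / ⟪a, a⟫) • a⟫ - b) < 0 := by
    rw [hpt]
    have := mul_self_pos.2 hε
    linarith
  have hz : {x : E n | ε * (⟪a, x⟫ - b) = 0} = {x | ⟪a, x⟫ = b} := by
    ext x
    simp [hε, sub_eq_zero]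
  -- The boundary is totally geodesic, so the constant potential `1` works.
  refine isSimpleNonGeneric_sublevel hn (l := 0) (g := ε • a) (a := 0) (b := 1) ?_
    (hconv.isConnected ⟨_, hne⟩) ?_ (fun x => ?_) (fun x _ => ?_) (fun x _ => ?_)
    ⟨_, hne, by simp⟩
  · exact contDiff_const.mul ((contDiff_const.inner ℝ contDiff_id).sub contDiff_const)
  · rw [hz]
    exact (convex_hyperplane (innerSL ℝ a).isLinear b).isConnected ⟨(b / ⟪a, a⟫) • a, hpt b⟩
  · rw [hg, zero_smul, zero_add]
  · rw [hg]
    exact smul_ne_zero hε ha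
  · simp

end EuclStatic

theorem mainTheorem1 (n : ℕ) (hn : 2 ≤ n) :
    -- the boundary of a simple non-generic domain is a round sphere or a hyperplane
    (∀ Ω : Set (EuclStatic.E n), EuclStatic.IsSimpleNonGeneric Ω →
      (∃ (c : EuclStatic.E n) (r : ℝ), 0 < r ∧ frontier Ω = Metric.sphere c r) ∨
      (∃ (a : EuclStatic.E n) (b : ℝ), a ≠ 0 ∧ frontier Ω = {x | ⟪a, x⟫ = b})) ∧
    -- for every round sphere, both sides are simple non-generic domains with that boundary
    (∀ (c : EuclStatic.E n) (r : ℝ), 0 < r →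
      (EuclStatic.IsSimpleNonGeneric (Metric.ball c r) ∧
        frontier (Metric.ball c r) = Metric.sphere c r) ∧
      (EuclStatic.IsSimpleNonGeneric (Metric.closedBall c r)ᶜ ∧
        frontier (Metric.closedBall c r)ᶜ = Metric.sphere c r)) ∧
    -- for every hyperplane, both sides are simple non-generic domains with that boundary
    (∀ (a : EuclStatic.E n) (b : ℝ), a ≠ 0 →
      (EuclStatic.IsSimpleNonGeneric {x : EuclStatic.E n | ⟪a, x⟫ < b} ∧
        frontier {x : EuclStatic.E n | ⟪a, x⟫ < b} = {x | ⟪a, x⟫ = b}) ∧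
      (EuclStatic.IsSimpleNonGeneric {x : EuclStatic.E n | b < ⟪a, x⟫} ∧
        frontier {x : EuclStatic.E n | b < ⟪a, x⟫} = {x | ⟪a, x⟫ = b})) := by
  refine ⟨fun Ω h => h.frontier_eq hn, fun c r hr => ⟨⟨?_, ?_⟩, ?_, ?_⟩,
    fun a b ha => ⟨⟨?_, ?_⟩, ?_, ?_⟩⟩
  · exact EuclStatic.isSimpleNonGeneric_ball hn c hr
  · exact frontier_ball c hr.ne'
  · exact EuclStatic.isSimpleNonGeneric_compl_closedBall hn c hr
  · rw [frontier_compl, frontier_closedBall c hr.ne']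
  · have h := EuclStatic.convex_halfSpace_inner_lt a b
    rw [EuclStatic.halfSpace_lt_eq] at h ⊢
    exact EuclStatic.isSimpleNonGeneric_halfSpace hn ha b one_ne_zero h
  · rw [EuclStatic.halfSpace_lt_eq]
    exact EuclStatic.frontier_halfSpace ha b one_ne_zero
  · have h := EuclStatic.convex_halfSpace_inner_gt a b
    rw [EuclStatic.halfSpace_gt_eq] at h ⊢
    exact EuclStatic.isSimpleNonGeneric_halfSpace hn ha b (neg_ne_zero.2 one_ne_zero) h
  · rw [EuclStatic.halfSpace_gt_eq]
    exact EuclStatic.frontier_halfSpace ha b (neg_ne_zero.2 one_ne_zero)
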